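/- For a positive integer $n$, let $t_n$ be the least integer $t\ge 0$ such that the integers $n+1,n+2,\dots,n+t$ contain a (possibly empty) subset the product of whose members with $n$ is a perfect square; in particular $t_n=0$ when $n$ is a square. Theorem 1.2. Let $\epsilon>0$ be fixed, and let the real number $x$ be sufficiently large depending on $\epsilon$. Then there are at least $$x\exp\Big(-\big(\tfrac{3\sqrt2}{2}+\epsilon\big)\sqrt{\log x\,\log\log x}\Big)$$ integers $n$ with $3\le n\le x$ such that $$t_n\le \exp\Big(\sqrt{(2+\epsilon)\log n\,\log\log n}\Big).$$ -/

import Mathlib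

/-- `SquareWithin n t`: the integers `n + 1, …, n + t` contain a (possibly empty) subset the product
of whose members with `n` is a perfect square. -/
def SquareWithin (n t : ℕ) : Prop :=
  ∃ S : Finset ℕ, S ⊆ Finset.Ioc n (n + t) ∧ IsSquare (n * ∏ m ∈ S, m)

/-- Some `t` always works: `n * (4 * n)` is a square. -/
theorem exists_squareWithin (n : ℕ) : ∃ t, SquareWithin n t := by
  rcases Nat.eq_zero_or_pos n with rfl | hn
  · exact ⟨0, ∅, by simp, by simp⟩
  · refine ⟨3 * n, {4 * n}, ?_, 2 * n, ?_⟩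
    · intro m hm
      simp only [Finset.mem_singleton] at hm
      simp only [Finset.mem_Ioc]
      omega
    · simp only [Finset.prod_singleton]
      ring

/-- The Erdős–Graham–Selfridge function `t_n`: the least nonnegative integer `t` such that
`n + 1, …, n + t` contain a subset the product of whose members with `n` is a square.
(The empty subset is allowed, so that `t_n = 0` when `n` is a square.) -/
noncomputable def squareGap (n : ℕ) : ℕ :=
  sInf {t : ℕ | SquareWithin n t}

/-- The infimum in `squareGap` is attained. -/
theorem squareGap_isLeast (n : ℕ) : IsLeast {t : ℕ | SquareWithin n t} (squareGap n) :=
  ⟨Nat.sInf_mem (exists_squareWithin n), fun _ ht => Nat.sInf_le ht⟩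

/-! Write s = √(log x · log log x), c = √2/2 and y = exp(c s). Two estimates are played against each
other. Few smooth numbers are bad: among more than π(y) y-smooth integers, the exponent vectors mod
2 are dependent, so some of them multiply to a square. In a window of length H the least of these
has gap at most H. Hence each window has at most π(y) bad smooth numbers, about x y / H up to x
(`card_not_squareWithin_le`). Smooth numbers are many: averaging over their prime factors in
(y^(1-δ), y] gives about x exp(-s/(2c)) of them (`le_card_smoothNumbersUpTo`), with Mertens' first
theorem as the only input on primes. With H = exp(b s), good ones remain once b > c + 1/(2c). The
right side is least at c = √2/2, with value √2, and the count is then x exp(-(√2/2 + o(1)) s). -/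

/-! ### Mertens' first theorem and reciprocal sums of primes. -/

open Real in
theorem log_div_mul_pred_le (n : ℕ) (hn : 2 ≤ n) :
    log n / (n * (n - 1)) ≤ (2 + log ((n - 1 : ℕ) : ℝ)) / ((n - 1 : ℕ) : ℝ) - (2 + log n) / n := by
  obtain ⟨m, rfl⟩ : ∃ m, n = m + 1 := ⟨n - 1, by omega⟩
  have hm : (1 : ℝ) ≤ m := by exact_mod_cast (by omega : 1 ≤ m)
  have hm0 : (0 : ℝ) < m := by linarith
  simp only [Nat.add_sub_cancel]
  push_cast
  have h1 : log ((m + 1 : ℝ) / m) ≤ (m + 1 : ℝ) / m - 1 := log_le_sub_one_of_pos (by positivity)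
  rw [log_div (by positivity) (by positivity)] at h1
  have h2 : (m + 1 : ℝ) / m - 1 = 1 / m := by field_simp; ring
  rw [h2] at h1
  have h3 : (m + 1 : ℝ) * (log (m + 1) - log m) ≤ 2 := by
    calc (m + 1 : ℝ) * (log (m + 1) - log m) ≤ (m + 1) * (1 / m) := by gcongr
      _ = 1 + 1 / m := by field_simp
      _ ≤ 2 := by
        have : 1 / (m : ℝ) ≤ 1 := by rw [div_le_one hm0]; exact hm
        linarith
  have h4 : (2 + log m) / m - (2 + log (m + 1)) / (m + 1 : ℝ)
      = (2 + log (m + 1) - (m + 1) * (log (m + 1) - log m)) / ((m + 1) * (m + 1 - 1)) := by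
    have : (m : ℝ) + 1 - 1 = m := by ring
    rw [this]
    field_simp
    ring
  rw [h4]
  apply div_le_div_of_nonneg_right _ (by nlinarith)
  linarith

-- The preceding bound telescopes. This sum pays for the higher prime powers in `N!`.
open Real in
theorem sum_log_div_mul_pred_le (N : ℕ) :
    ∑ n ∈ Finset.Icc 2 N, log n / (n * (n - 1)) ≤ 2 := by
  have key : ∀ N : ℕ, 1 ≤ N →
      ∑ n ∈ Finset.Icc 2 N, log n / (n * (n - 1)) ≤ 2 - (2 + log N) / N := by
    intro N hN
    induction N, hN using Nat.le_induction with
    | base => simp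
    | succ m hm ih =>
      rw [Finset.sum_Icc_succ_top (by omega)]
      have := log_div_mul_pred_le (m + 1) (by omega)
      simp only [Nat.add_sub_cancel] at this
      linarith
  rcases Nat.eq_zero_or_pos N with rfl | hN
  · simp
  · have h1 := key N hN
    have h2 : (0 : ℝ) ≤ (2 + log N) / N := by
      have := log_natCast_nonneg N
      positivity
    linarith

open Real in
theorem log_factorial_eq_sum_primesLE (N : ℕ) :
    log (N.factorial : ℝ) = ∑ p ∈ N.primesLE, (N.factorial.factorization p : ℝ) * log p := by
  rw [log_nat_eq_sum_factorization, Finsupp.sum]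
  apply Finset.sum_subset
  · intro p hp
    rw [Nat.support_factorization, Nat.mem_primeFactors] at hp
    rw [Nat.mem_primesLE]
    exact ⟨(hp.1.dvd_factorial).1 hp.2.1, hp.1⟩
  · intro p _ hp
    rw [Finsupp.notMem_support_iff.1 hp]
    simp

open Real in
/-- Mertens' first theorem, lower bound. -/
theorem log_sub_three_le_sum_log_div (N : ℕ) (hN : 1 ≤ N) :
    log N - 3 ≤ ∑ p ∈ N.primesLE, log p / p := by
  have hN0 : (0 : ℝ) < N := by exact_mod_cast hN
  have h1 : N * log N - N ≤ log (N.factorial : ℝ) := by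
    have h : (N : ℝ) ^ N / N.factorial ≤ exp N := pow_div_factorial_le_exp (N : ℝ) hN0.le N
    have h' := log_le_log (by positivity) h
    rw [log_exp, log_div (by positivity) (by positivity), log_pow] at h'
    linarith
  have h2 : log (N.factorial : ℝ) ≤ ∑ p ∈ N.primesLE, N * (log p / p + log p / (p * (p - 1))) := by
    rw [log_factorial_eq_sum_primesLE]
    refine Finset.sum_le_sum fun p hp => ?_
    rw [Nat.mem_primesLE] at hp
    have hp2 : (2 : ℝ) ≤ p := by exact_mod_cast hp.2.two_le
    -- Legendre: the left side is `N` minus its base-`p` digit sum.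
    have h3 : (p - 1) * N.factorial.factorization p ≤ N := by
      rw [Nat.sub_one_mul_factorization_factorial hp.2]
      exact Nat.sub_le _ _
    have h4 : ((p : ℝ) - 1) * N.factorial.factorization p ≤ N := by
      have := hp.2.one_le
      exact_mod_cast h3
    have h5 : log p / p + log p / (p * (p - 1)) = log p / (p - 1) := by
      have : (p : ℝ) - 1 ≠ 0 := by linarith
      field_simp
      ring
    have h6 : (N.factorial.factorization p : ℝ) ≤ N / (p - 1) := by
      rw [le_div_iff₀ (by linarith)]
      linarith
    rw [h5]
    calc _ ≤ N / ((p : ℝ) - 1) * log p := by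
          gcongr
      _ = _ := by ring
  rw [← Finset.mul_sum, Finset.sum_add_distrib] at h2
  have h3 : ∑ p ∈ N.primesLE, log p / (p * (p - 1)) ≤ 2 := by
    refine le_trans (Finset.sum_le_sum_of_subset_of_nonneg ?_ ?_) (sum_log_div_mul_pred_le N)
    · intro p hp
      rw [Nat.mem_primesLE] at hp
      exact Finset.mem_Icc.2 ⟨hp.2.two_le, hp.1⟩
    · intro n hn _
      have hn2 : (2 : ℝ) ≤ n := by exact_mod_cast (Finset.mem_Icc.1 hn).1
      have := log_nonneg (by linarith : (1 : ℝ) ≤ n)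
      exact div_nonneg this (by nlinarith)
  have h4 : N * (log N - 1) ≤ N * (∑ p ∈ N.primesLE, log p / p + 2) := by
    calc _ = N * log N - N := by ring
      _ ≤ _ := h1.trans h2
      _ ≤ _ := by gcongr
  have := le_of_mul_le_mul_left h4 hN0
  linarith

open Real in
/-- Mertens' first theorem, upper bound. -/
theorem sum_log_div_le_log_add_log_four (N : ℕ) (hN : 1 ≤ N) :
    ∑ p ∈ N.primesLE, log p / p ≤ log N + log 4 := by
  have hN0 : (0 : ℝ) < N := by exact_mod_cast hN
  have h1 : log (N.factorial : ℝ) ≤ N * log N := by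
    rw [← log_pow]
    apply log_le_log (by positivity)
    exact_mod_cast Nat.factorial_le_pow N
  -- Only the first term `N / p` of Legendre's formula is kept; the rounding losses add up to θ(N) ≤
  -- N log 4.
  have h2 : ∑ p ∈ N.primesLE, (N * (log p / p) - log p) ≤ log (N.factorial : ℝ) := by
    rw [log_factorial_eq_sum_primesLE]
    refine Finset.sum_le_sum fun p hp => ?_
    rw [Nat.mem_primesLE] at hp
    have hp2 : (2 : ℝ) ≤ p := by exact_mod_cast hp.2.two_le
    have h3 : N / p ≤ N.factorial.factorization p := by
      rw [Nat.factorization_factorial hp.2 (b := Nat.log p N + 2) (by omega)]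
      have := Finset.single_le_sum (f := fun i => N / p ^ i)
        (s := Finset.Ico 1 (Nat.log p N + 2)) (fun _ _ => Nat.zero_le _)
        (Finset.mem_Ico.2 ⟨le_refl 1, by omega⟩)
      simpa using this
    have h4 : (N : ℝ) / p - 1 ≤ N.factorial.factorization p := by
      have h5 : (N : ℝ) / p < (N / p : ℕ) + 1 := by
        rw [← Nat.floor_div_eq_div (K := ℝ)]
        exact Nat.lt_floor_add_one _
      have : ((N / p : ℕ) : ℝ) ≤ N.factorial.factorization p := by exact_mod_cast h3
      linarith
    calc _ = ((N : ℝ) / p - 1) * log p := by ring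
      _ ≤ _ := by
        gcongr
  rw [Finset.sum_sub_distrib, ← Finset.mul_sum, ← Chebyshev.theta_eq_sum_primesLE_log] at h2
  have h3 := Chebyshev.theta_le_log4_mul_x hN0.le
  have h4 : N * ∑ p ∈ N.primesLE, log p / p ≤ N * (log N + log 4) := by
    linarith
  exact le_of_mul_le_mul_left h4 hN0

open Real in
theorem log_sub_log_sub_le_sum_prime_Ioc (a b : ℕ) (ha : 1 ≤ a) (hab : a ≤ b) :
    log b - log a - 5 ≤ ∑ p ∈ Finset.Ioc a b with p.Prime, log p / p := by
  have h1 := log_sub_three_le_sum_log_div b (ha.trans hab)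
  have h2 := sum_log_div_le_log_add_log_four a ha
  have h3 : ∑ p ∈ b.primesLE, log p / (p : ℝ) = ∑ p ∈ a.primesLE, log p / (p : ℝ) +
      ∑ p ∈ Finset.Ioc a b with p.Prime, log p / p := by
    rw [← Finset.sum_union]
    · congr 1
      ext p
      simp only [Nat.mem_primesLE, Finset.mem_union, Finset.mem_filter, Finset.mem_Ioc]
      constructor
      · rintro ⟨h, hp⟩
        by_cases hpa : p ≤ a
        · exact Or.inl ⟨hpa, hp⟩
        · exact Or.inr ⟨⟨by omega, h⟩, hp⟩
      · rintro (⟨h, hp⟩ | ⟨h, hp⟩)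
        · exact ⟨h.trans hab, hp⟩
        · exact ⟨h.2, hp⟩
    · rw [Finset.disjoint_left]
      intro p hp hp'
      simp only [Nat.mem_primesLE, Finset.mem_filter, Finset.mem_Ioc] at hp hp'
      omega
  have h4 : log 4 ≤ 2 := by
    rw [show (4 : ℝ) = 2 ^ 2 by norm_num, log_pow]
    have := log_two_lt_d9
    push_cast
    linarith
  linarith

open Real in
/-- The primes in `(y ^ (1 - δ), y]` have reciprocal sum bounded below. -/
theorem half_le_sum_inv_prime (δ y : ℝ) (hδ : 0 < δ) (hδ1 : δ < 1) (hy : 12 / δ ≤ log y)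
    (hy0 : 0 < y) :
    δ / 2 ≤ ∑ p ∈ Finset.Ioc ⌊y ^ (1 - δ)⌋₊ ⌊y⌋₊ with p.Prime, (1 : ℝ) / p := by
  -- The errors, 5 from Mertens and 1 from the floor of `y`, then use at most half of `δ * log y`.
  have hlog : 12 ≤ δ * log y := by
    rw [div_le_iff₀ hδ] at hy
    linarith
  have hlog0 : 0 < log y := by
    by_contra h
    push Not at h
    nlinarith
  have hy1 : 1 < y := (log_pos_iff hy0.le).1 hlog0
  have hz1 : 1 ≤ y ^ (1 - δ) := one_le_rpow hy1.le (by linarith)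
  have hzy : y ^ (1 - δ) ≤ y := by
    conv_rhs => rw [← rpow_one y]
    exact rpow_le_rpow_of_exponent_le hy1.le (by linarith)
  have ha : 1 ≤ ⌊y ^ (1 - δ)⌋₊ := Nat.one_le_floor_iff _ |>.2 hz1
  have hab := Nat.floor_le_floor hzy
  have h1 := log_sub_log_sub_le_sum_prime_Ioc _ _ ha hab
  have h2 : log (⌊y ^ (1 - δ)⌋₊ : ℝ) ≤ (1 - δ) * log y := by
    rw [← log_rpow hy0]
    exact log_le_log (by exact_mod_cast ha) (Nat.floor_le (by linarith))
  have h3 : log y - 1 ≤ log (⌊y⌋₊ : ℝ) := by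
    have hb : (1 : ℝ) ≤ ⌊y⌋₊ := by exact_mod_cast ha.trans hab
    have h4 : y ≤ 2 * ⌊y⌋₊ := by
      have := Nat.lt_floor_add_one y
      linarith
    have h5 := log_le_log hy0 h4
    rw [log_mul (by norm_num) (by linarith)] at h5
    have := log_two_lt_d9
    linarith
  have h4 : ∑ p ∈ Finset.Ioc ⌊y ^ (1 - δ)⌋₊ ⌊y⌋₊ with p.Prime, log p / p ≤
      log y * ∑ p ∈ Finset.Ioc ⌊y ^ (1 - δ)⌋₊ ⌊y⌋₊ with p.Prime, (1 : ℝ) / p := by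
    rw [Finset.mul_sum]
    refine Finset.sum_le_sum fun p hp => ?_
    rw [Finset.mem_filter, Finset.mem_Ioc] at hp
    have hp0 : (0 : ℝ) < p := by exact_mod_cast hp.2.pos
    have : log p ≤ log y := log_le_log hp0
      (((Nat.le_floor_iff hy0.le).1 hp.1.2))
    rw [mul_one_div]
    gcongr
  have h5 : log y * (δ / 2) ≤
      log y * ∑ p ∈ Finset.Ioc ⌊y ^ (1 - δ)⌋₊ ⌊y⌋₊ with p.Prime, (1 : ℝ) / p := by
    linarith
  exact le_of_mul_le_mul_left h5 hlog0

/-! ### Square products by linear algebra over 𝔽₂. -/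

theorem Nat.isSquare_of_forall_even_factorization (n : ℕ) (hn : n ≠ 0)
    (h : ∀ p, p.Prime → Even (n.factorization p)) : IsSquare n := by
  rw [← Nat.prod_factorization_pow_eq_self hn, Finsupp.prod]
  refine Finset.isSquare_prod _ fun p hp => ?_
  have hp' := Nat.prime_of_mem_primeFactors (Nat.support_factorization n ▸ hp)
  exact (h p hp').isSquare_pow p

/-- More `k`-smooth numbers than there are primes below `k` have a nonempty subset whose product
is a square. -/
theorem exists_isSquare_prod_of_card_lt (k : ℕ) (B : Finset ℕ)
    (hB : ∀ n ∈ B, n ∈ Nat.smoothNumbers k) (hcard : k.primesBelow.card < B.card) :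
    ∃ T ⊆ B, T.Nonempty ∧ IsSquare (∏ n ∈ T, n) := by
  let v : B → (k.primesBelow → ZMod 2) := fun n p => ((n : ℕ).factorization p : ZMod 2)
  have hdep : ¬ LinearIndependent (ZMod 2) v := by
    intro hli
    have := hli.fintype_card_le_finrank
    simp only [Fintype.card_coe, Module.finrank_fintype_fun_eq_card] at this
    omega
  obtain ⟨g, hg, i, hi⟩ := Fintype.not_linearIndependent_iff.1 hdep
  have hone : ∀ a : ZMod 2, a ≠ 0 → a = 1 := by decide
  let U : Finset B := Finset.univ.filter fun n => g n ≠ 0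
  have hne : ∀ n ∈ U, (n : ℕ) ≠ 0 := fun n _ => (hB n n.2).1
  refine ⟨U.map (Function.Embedding.subtype _), ?_, ?_, ?_⟩
  · intro n hn
    obtain ⟨m, -, rfl⟩ := Finset.mem_map.1 hn
    exact m.2
  · exact (Finset.map_nonempty).2 ⟨i, Finset.mem_filter.2 ⟨Finset.mem_univ _, hi⟩⟩
  · rw [Finset.prod_map]
    simp only [Function.Embedding.subtype_apply]
    apply Nat.isSquare_of_forall_even_factorization _ (Finset.prod_ne_zero_iff.2 hne)
    intro p hp
    rw [Nat.factorization_prod hne, Finsupp.finsetSum_apply]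
    by_cases hpk : p < k
    · have h1 := congrFun hg ⟨p, Nat.mem_primesBelow.2 ⟨hpk, hp⟩⟩
      simp only [Finset.sum_apply, Pi.smul_apply, smul_eq_mul, Pi.zero_apply, v] at h1
      rw [← ZMod.natCast_eq_zero_iff_even, Nat.cast_sum, Finset.sum_filter]
      refine Eq.trans (Finset.sum_congr rfl fun n _ => ?_) h1
      split_ifs with h
      · rw [hone _ h, one_mul]
      · rw [not_not.1 h, zero_mul]
    · rw [Finset.sum_eq_zero]
      · exact Even.zero
      · intro n _
        apply Nat.factorization_eq_zero_of_not_dvd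
        intro hdvd
        exact hpk (Nat.mem_smoothNumbers'.1 (hB n n.2) p hp hdvd)

/-- Within a window of length `H`, few smooth numbers fail `SquareWithin n H`. -/
theorem card_not_squareWithin_window_le (k H : ℕ) (B : Finset ℕ)
    (hB : ∀ n ∈ B, n ∈ Nat.smoothNumbers k) (hbad : ∀ n ∈ B, ¬ SquareWithin n H)
    (hwin : ∀ m ∈ B, ∀ n ∈ B, n ≤ m + H) : B.card ≤ k.primesBelow.card := by
  by_contra hlt
  obtain ⟨T, hTB, hT, hsq⟩ := exists_isSquare_prod_of_card_lt k B hB (not_le.1 hlt)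
  -- The least element of `T` plays the role of `n`; the rest of `T` lies within `H` above it.
  have hm := T.min'_mem hT
  refine hbad _ (hTB hm) ⟨T.erase (T.min' hT), ?_, ?_⟩
  · intro n hn
    rw [Finset.mem_erase] at hn
    exact Finset.mem_Ioc.2 ⟨lt_of_le_of_ne (T.min'_le n hn.2) (Ne.symm hn.1),
      hwin _ (hTB hm) _ (hTB hn.2)⟩
  · rwa [Finset.mul_prod_erase T (fun n => n) hm]

/-- The windows are the fibres of `n ↦ n / H`. -/
theorem card_not_squareWithin_le (k H N : ℕ) (hH : 0 < H) (B : Finset ℕ)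
    (hB : ∀ n ∈ B, n ∈ Nat.smoothNumbers k) (hbad : ∀ n ∈ B, ¬ SquareWithin n H)
    (hN : ∀ n ∈ B, n ≤ N) : B.card ≤ (N / H + 1) * k := by
  have h := Finset.card_le_mul_card_image_of_maps_to (s := B) (t := Finset.range (N / H + 1))
    (f := fun n => n / H) (n := k.primesBelow.card) (fun n hn => by
      rw [Finset.mem_range]
      exact Nat.lt_succ_of_le (Nat.div_le_div_right (hN n hn))) (fun q _ => by
      refine card_not_squareWithin_window_le k H _ (fun n hn => hB n (Finset.filter_subset _ _ hn))
        (fun n hn => hbad n (Finset.filter_subset _ _ hn)) ?_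
      intro m hm n hn
      have hm' := (Finset.mem_filter.1 hm).2
      have hn' := (Finset.mem_filter.1 hn).2
      have h1 := Nat.div_add_mod m H
      have h2 := Nat.div_add_mod n H
      have h3 := Nat.mod_lt n hH
      rw [hm'] at h1
      rw [hn'] at h2
      omega)
  have hk : k.primesBelow.card ≤ k := by
    refine (Finset.card_filter_le _ _).trans ?_
    simp
  rw [Finset.card_range, mul_comm] at h
  exact h.trans (Nat.mul_le_mul_left _ hk)

/-! ### Lower bounds for counts of smooth numbers. -/

/-- Averaging over the primes in `P` that divide a smooth number. -/
theorem sum_card_smoothNumbersUpTo_div_le (k N : ℕ) (P : Finset ℕ) (K : ℝ)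
    (hP : ∀ p ∈ P, p.Prime ∧ p < k)
    (hK : ∀ n, n ≠ 0 → n ≤ N → ((P.filter (· ∣ n)).card : ℝ) ≤ K) :
    ∑ p ∈ P, ((Nat.smoothNumbersUpTo (N / p) k).card : ℝ) ≤
      K * (Nat.smoothNumbersUpTo N k).card := by
  have h1 : ∀ p ∈ P, (Nat.smoothNumbersUpTo (N / p) k).card ≤
      ((Nat.smoothNumbersUpTo N k).filter (p ∣ ·)).card := by
    intro p hp
    have hp0 := (hP p hp).1.pos
    refine Finset.card_le_card_of_injOn (fun m => p * m) ?_ ?_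
    · intro m hm
      rw [Finset.mem_coe, Nat.mem_smoothNumbersUpTo] at hm
      simp only [Finset.coe_filter, Set.mem_ofPred_eq, Nat.mem_smoothNumbersUpTo]
      refine ⟨⟨?_, ?_⟩, dvd_mul_right p m⟩
      · rw [mul_comm]
        exact (Nat.le_div_iff_mul_le hp0).1 hm.1
      · exact Nat.mul_mem_smoothNumbers (Nat.mem_smoothNumbers_of_lt hp0 (hP p hp).2) hm.2
    · intro a _ b _ hab
      exact Nat.eq_of_mul_eq_mul_left hp0 hab
  calc ∑ p ∈ P, ((Nat.smoothNumbersUpTo (N / p) k).card : ℝ)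
      ≤ ∑ p ∈ P, (((Nat.smoothNumbersUpTo N k).filter (p ∣ ·)).card : ℝ) :=
        Finset.sum_le_sum fun p hp => by exact_mod_cast h1 p hp
    _ = ∑ n ∈ Nat.smoothNumbersUpTo N k, ((P.filter (· ∣ n)).card : ℝ) := by
        exact_mod_cast Finset.sum_card_bipartiteAbove_eq_sum_card_bipartiteBelow
          (s := P) (t := Nat.smoothNumbersUpTo N k) (fun p n => p ∣ n)
    _ ≤ ∑ n ∈ Nat.smoothNumbersUpTo N k, K := by
        refine Finset.sum_le_sum fun n hn => ?_
        rw [Nat.mem_smoothNumbersUpTo] at hn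
        exact hK n hn.2.1 hn.1
    _ = _ := by rw [Finset.sum_const, nsmul_eq_mul, mul_comm]

/-- A lower bound for the number of smooth numbers up to `X`, from primes in `(z, y]`. -/
theorem le_card_smoothNumbersUpTo (y z K r : ℝ) (N : ℕ) (P : Finset ℕ) (hz : 0 < z)
    (hK0 : 0 < K) (hr0 : 0 ≤ r) (hr1 : r ≤ 1)
    (hP : ∀ p ∈ P, p.Prime ∧ z ≤ p ∧ p ≤ y)
    (hK : ∀ n, n ≠ 0 → n ≤ N → ((P.filter (· ∣ n)).card : ℝ) ≤ K)
    (hS : r * K ≤ ∑ p ∈ P, (1 : ℝ) / p) (j : ℕ) :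
    ∀ X : ℝ, 1 ≤ X → ⌊X⌋₊ ≤ N → X ≤ y * z ^ j →
      X / 2 * r ^ j ≤ (Nat.smoothNumbersUpTo ⌊X⌋₊ (⌊y⌋₊ + 1)).card := by
  have hbase : ∀ X : ℝ, 1 ≤ X → X ≤ y →
      X / 2 ≤ (Nat.smoothNumbersUpTo ⌊X⌋₊ (⌊y⌋₊ + 1)).card := by
    intro X hX hXy
    have h1 : Finset.Icc 1 ⌊X⌋₊ ⊆ Nat.smoothNumbersUpTo ⌊X⌋₊ (⌊y⌋₊ + 1) := by
      intro n hn
      rw [Finset.mem_Icc] at hn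
      have := Nat.floor_le_floor hXy
      exact Nat.mem_smoothNumbersUpTo.2 ⟨hn.2, Nat.mem_smoothNumbers_of_lt hn.1 (by omega)⟩
    have h2 := Finset.card_le_card h1
    rw [Nat.card_Icc, Nat.add_sub_cancel] at h2
    have h3 : ((⌊X⌋₊ : ℕ) : ℝ) ≤ (Nat.smoothNumbersUpTo ⌊X⌋₊ (⌊y⌋₊ + 1)).card := by
      exact_mod_cast h2
    have h4 := Nat.lt_floor_add_one X
    have h5 : (1 : ℝ) ≤ ⌊X⌋₊ := by exact_mod_cast (Nat.one_le_floor_iff X).2 hX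
    linarith
  induction j with
  | zero =>
    intro X hX _ hXy
    simpa using hbase X hX (by simpa using hXy)
  | succ j ih =>
    intro X hX hXN hXy
    -- When `X > y`, every `X / p` is at least 1, so induction applies; each averaging step costs a
    -- factor `r`.
    by_cases hle : X ≤ y
    · refine le_trans ?_ (hbase X hX hle)
      exact mul_le_of_le_one_right (by linarith) (pow_le_one₀ hr0 hr1)
    · push Not at hle
      have h1 := sum_card_smoothNumbersUpTo_div_le (⌊y⌋₊ + 1) ⌊X⌋₊ P K
        (fun p hp => ⟨(hP p hp).1, Nat.lt_succ_of_le (Nat.le_floor (hP p hp).2.2)⟩)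
        (fun n hn hnX => hK n hn (hnX.trans hXN))
      have h2 : ∑ p ∈ P, X / p / 2 * r ^ j ≤
          ∑ p ∈ P, ((Nat.smoothNumbersUpTo (⌊X⌋₊ / p) (⌊y⌋₊ + 1)).card : ℝ) := by
        refine Finset.sum_le_sum fun p hp => ?_
        obtain ⟨hp, hzp, hpy⟩ := hP p hp
        have hp0 : (0 : ℝ) < p := by exact_mod_cast hp.pos
        rw [← Nat.floor_div_natCast]
        refine ih (X / p) ?_ ?_ ?_
        · rw [one_le_div hp0]
          linarith
        · rw [Nat.floor_div_natCast]
          exact (Nat.div_le_self _ _).trans hXN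
        · rw [div_le_iff₀ hp0]
          refine hXy.trans ?_
          rw [pow_succ, ← mul_assoc]
          have hy0 : 0 ≤ y := hp0.le.trans hpy
          gcongr
      have h3 : ∑ p ∈ P, X / p / 2 * r ^ j = X / 2 * r ^ j * ∑ p ∈ P, (1 : ℝ) / p := by
        rw [Finset.mul_sum]
        refine Finset.sum_congr rfl fun p _ => ?_
        ring
      have h4 : X / 2 * r ^ j * (r * K) ≤ X / 2 * r ^ j * ∑ p ∈ P, (1 : ℝ) / p := by
        gcongr
      have h5 : K * (X / 2 * r ^ (j + 1)) ≤
          K * (Nat.smoothNumbersUpTo ⌊X⌋₊ (⌊y⌋₊ + 1)).card := by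
        calc _ = X / 2 * r ^ j * (r * K) := by ring
          _ ≤ _ := by linarith
      exact le_of_mul_le_mul_left h5 hK0

open Real in
/-- An integer `n ≤ N` has at most `log N / log z` prime factors exceeding `z`. -/
theorem card_filter_dvd_le (z : ℝ) (hz : 1 < z) (P : Finset ℕ) (hP : ∀ p ∈ P, p.Prime ∧ z ≤ p)
    (n : ℕ) (hn : n ≠ 0) : ((P.filter (· ∣ n)).card : ℝ) ≤ log n / log z := by
  rw [le_div_iff₀ (log_pos hz), ← log_pow]
  apply log_le_log (by positivity)
  have h1 : ∏ p ∈ P.filter (· ∣ n), p ∣ n := by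
    apply Finset.prod_primes_dvd
    · intro p hp
      exact (hP p (Finset.mem_filter.1 hp).1).1.prime
    · intro p hp
      exact (Finset.mem_filter.1 hp).2
  have h2 : (∏ p ∈ P.filter (· ∣ n), (p : ℝ)) ≤ n := by
    rw [← Nat.cast_prod]
    exact_mod_cast Nat.le_of_dvd (Nat.pos_of_ne_zero hn) h1
  refine le_trans ?_ h2
  rw [← Finset.prod_const]
  exact Finset.prod_le_prod (fun _ _ => by linarith)
    fun p hp => (hP p (Finset.mem_filter.1 hp).1).2

open Real Filter in
theorem eventually_mul_log_log_le_log (C : ℝ) : ∀ᶠ x in atTop, C * log (log x) ≤ log x := by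
  have h1 : ∀ᶠ t : ℝ in atTop, C * log t ≤ t := by
    have h := isLittleO_log_id_atTop.const_mul_left C
    filter_upwards [h.bound one_pos, eventually_ge_atTop 0] with t ht ht0
    simp only [id, one_mul, norm_eq_abs, abs_of_nonneg ht0] at ht
    exact (le_abs_self _).trans ht
  exact tendsto_log_atTop.eventually h1

open Real in
/-- The number of `exp (√2 / 2 * s)`-smooth integers up to `x`, `s = √(log x * log (log x))`. -/
theorem le_card_smoothNumbersUpTo_exp (δ x s : ℝ) (hδ : 0 < δ) (hδ1 : δ < 1) (hx : 1 < x)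
    (hs : s = √(log x * log (log x))) (hm : 1 ≤ log (log x)) (hml : log (log x) ≤ log x)
    (hmδ : 2 / (δ * (1 - δ) * (√2 / 2)) ≤ √(log (log x)))
    (hsδ : 12 / δ ≤ √2 / 2 * s) :
    x / 2 * exp (-(√2 / 2 / (1 - δ) * s + log (log x) / 2)) ≤
      (Nat.smoothNumbersUpTo ⌊x⌋₊ (⌊exp (√2 / 2 * s)⌋₊ + 1)).card := by
  set l := log x with hl
  set m := log l with hm'
  set c : ℝ := √2 / 2 with hc
  have hc0 : 0 < c := by positivity
  have hcc : c * c = 1 / 2 := by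
    rw [hc, div_mul_div_comm, mul_self_sqrt (by norm_num)]
    norm_num
  have hc1 : c ≤ 1 := by nlinarith
  have hl0 : 0 < l := by linarith
  have hss : s * s = l * m := by rw [hs, mul_self_sqrt (by nlinarith)]
  have hs1 : 1 ≤ s := by
    rw [hs]
    exact one_le_sqrt.2 (by nlinarith)
  have hsl : s ≤ l := by nlinarith
  have h1δ : 0 < 1 - δ := by linarith
  set y := exp (c * s) with hy
  have hy0 : 0 < y := exp_pos _
  have hlogy : log y = c * s := log_exp _
  set z := y ^ (1 - δ) with hz
  have hlogz : log z = (1 - δ) * (c * s) := by rw [hz, log_rpow hy0, hlogy]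
  have hlogz0 : 0 < log z := by rw [hlogz]; positivity
  have hz0 : 0 < z := rpow_pos_of_pos hy0 _
  have hz1 : 1 < z := (log_pos_iff hz0.le).1 hlogz0
  set K := l / log z with hK
  have hzl : log z ≤ l := by
    rw [hlogz]
    nlinarith [mul_le_mul_of_nonneg_left hc1 (by linarith : 0 ≤ s)]
  have hK1 : 1 ≤ K := (one_le_div hlogz0).2 hzl
  -- Enough steps for `z ^ J ≥ x`.
  set J := ⌈K⌉₊ with hJ
  have hJK : (J : ℝ) ≤ K + 1 := (Nat.ceil_lt_add_one (by linarith)).le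
  set P := Finset.filter Nat.Prime (Finset.Ioc ⌊z⌋₊ ⌊y⌋₊) with hP
  have hPmem : ∀ p ∈ P, p.Prime ∧ z ≤ p ∧ (p : ℝ) ≤ y := by
    intro p hp
    rw [hP, Finset.mem_filter, Finset.mem_Ioc] at hp
    exact ⟨hp.2, (Nat.lt_of_floor_lt hp.1.1).le, (Nat.le_floor_iff hy0.le).1 hp.1.2⟩
  have hS := half_le_sum_inv_prime δ y hδ hδ1 (by rw [hlogy]; exact hsδ) hy0
  have hr1 : δ / (2 * K) ≤ 1 := by
    rw [div_le_one (by linarith)]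
    linarith
  have hmain := le_card_smoothNumbersUpTo y z K (δ / (2 * K)) ⌊x⌋₊ P hz0 (by linarith)
    (by positivity) hr1 hPmem (fun n hn hnx => by
      refine (card_filter_dvd_le z hz1 P (fun p hp => ⟨(hPmem p hp).1, (hPmem p hp).2.1⟩) n hn).trans
        ?_
      rw [hK]
      gcongr
      exact log_le_log (by exact_mod_cast Nat.pos_of_ne_zero hn)
        ((Nat.le_floor_iff (by linarith)).1 hnx))
    (by
      have : δ / (2 * K) * K = δ / 2 := by field_simp
      rw [this]
      exact hS) J x hx.le le_rfl (by
      have h1 : x ≤ z ^ J := by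
        rw [← log_le_log_iff (by linarith) (by positivity), log_pow]
        calc log x = K * log z := (div_mul_cancel₀ _ hlogz0.ne').symm
          _ ≤ J * log z := by gcongr; exact Nat.le_ceil K
      have h2 : 1 ≤ y := one_le_exp (by positivity)
      nlinarith [pow_pos hz0 J])
  refine le_trans ?_ hmain
  -- The main exponent: `K` steps costing `m / 2` each, simplified by `c * c = 1 / 2`.
  have hKs : K * m / 2 = c / (1 - δ) * s := by
    rw [hK, hlogz]
    field_simp
    nlinarith
  have hKm : 2 * K / δ ≤ exp (m / 2) := by
    have h1 : exp (m / 2) = √l := by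
      rw [exp_half, hm', exp_log hl0]
    have h2 : s = √l * √m := by rw [hs, sqrt_mul hl0.le]
    have hm0 : 0 < √m := sqrt_pos.2 (by linarith)
    have hsl0 : 0 < √l := sqrt_pos.2 hl0
    have h3 : l = √l * √l := (mul_self_sqrt hl0.le).symm
    have h4 : 2 * K / δ = 2 / (δ * (1 - δ) * c) * (√l / √m) := by
      rw [hK, hlogz, h2]
      nth_rewrite 1 [h3]
      field_simp
    rw [h1, h4]
    calc _ ≤ √m * (√l / √m) := by gcongr
      _ = √l := by field_simp
  have hr : exp (-(m / 2)) ≤ δ / (2 * K) := by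
    rw [exp_neg, ← inv_div (2 * K) δ]
    exact inv_anti₀ (by positivity) hKm
  have hpow : exp (-(c / (1 - δ) * s + m / 2)) ≤ (δ / (2 * K)) ^ J := by
    calc exp (-(c / (1 - δ) * s + m / 2)) ≤ exp (J * -(m / 2)) := by
          apply exp_le_exp.2
          have := mul_le_mul_of_nonneg_right hJK (by linarith : 0 ≤ m / 2)
          linarith
      _ = exp (-(m / 2)) ^ J := by rw [exp_nat_mul]
      _ ≤ _ := by gcongr
  gcongr

/-! ### Comparing smooth and bad numbers, and passage from `x` to `n`. -/

open Real in
/-- Smooth integers with a short square gap are plentiful. -/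
theorem le_ncard_squareGap_le (κ θ x s b : ℝ) (G : Set ℕ) (hκ : 0 < κ) (hκ1 : κ ≤ 1)
    (hb : √2 + κ ≤ b) (hx : 1 < x)
    (hs : s = √(log x * log (log x))) (hm : 1 ≤ log (log x)) (hml : log (log x) ≤ log x)
    (hmκ : 2 / (κ / 4 * (1 - κ / 4) * (√2 / 2)) ≤ √(log (log x)))
    (hms : log (log x) ≤ κ / 4 * s)
    (hsκ : 48 / κ ≤ √2 / 2 * s) (hsl : 4 * s ≤ log x) (hsθ : 2 * s ≤ (1 - θ) * log x)
    (hG : ∀ n : ℕ, x ^ θ < n → (n : ℝ) ≤ x → (squareGap n : ℝ) ≤ exp (b * s) → n ∈ G)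
    (hGfin : G.Finite) :
    x * exp (-((√2 / 2 + κ / 2) * s)) ≤ G.ncard := by
  have hΨ := le_card_smoothNumbersUpTo_exp (κ / 4) x s (by positivity) (by linarith) hx hs hm hml
    hmκ (by rwa [show (12 : ℝ) / (κ / 4) = 48 / κ by field_simp; norm_num])
  have hx0 : 0 < x := by linarith
  set c : ℝ := √2 / 2 with hc
  have hc0 : 0 < c := by positivity
  have hcc : c * c = 1 / 2 := by
    rw [hc, div_mul_div_comm, mul_self_sqrt (by norm_num)]
    norm_num
  have hc1 : c ≤ 3 / 4 := by nlinarith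
  have hb' : 2 * c + κ ≤ b := by rw [hc]; linarith
  have hκs : 48 ≤ κ * s := by
    rw [div_le_iff₀ hκ] at hsκ
    have : 0 ≤ κ * s := by linarith
    nlinarith
  have hs1 : 1 ≤ s := by nlinarith
  set E := x * exp (-((c + κ / 2) * s)) with hE
  set k := ⌊exp (c * s)⌋₊ + 1 with hk
  set H := ⌊exp (b * s)⌋₊ with hH
  have hbs : 0 < b * s := mul_pos (by linarith) (by linarith)
  have hHlow : exp (b * s) / 2 ≤ H := by
    have h1 : 1 ≤ exp (b * s) := one_le_exp hbs.le
    have h2 := Nat.lt_floor_add_one (exp (b * s))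
    have h3 : (1 : ℝ) ≤ H := by exact_mod_cast (Nat.one_le_floor_iff _).2 h1
    linarith
  have hH0 : 0 < H := by
    have := exp_pos (b * s)
    exact_mod_cast (by linarith : (0 : ℝ) < H)
  have hkup : (k : ℝ) ≤ 2 * exp (c * s) := by
    have h1 : 1 ≤ exp (c * s) := one_le_exp (by positivity)
    have h2 := Nat.floor_le (exp_pos (c * s)).le
    rw [hk]
    push_cast
    linarith
  -- Of `4 * E` smooth numbers, at most `2 * E` are bad and `E` lie below `x ^ θ`, which leaves `E`.
  have hmainlow : 4 * E ≤ (Nat.smoothNumbersUpTo ⌊x⌋₊ k).card := by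
    refine le_trans ?_ hΨ
    have h1 : c / (1 - κ / 4) ≤ c + κ / 4 := by
      rw [div_le_iff₀ (by linarith)]
      nlinarith
    have h2 : 8 ≤ exp (κ * s / 8) := by
      have h := quadratic_le_exp_of_nonneg (x := κ * s / 8) (by positivity)
      nlinarith
    have h3 : 8 * exp (-((c + κ / 2) * s)) ≤ exp (-(c / (1 - κ / 4) * s + log (log x) / 2)) := by
      calc _ ≤ exp (κ * s / 8) * exp (-((c + κ / 2) * s)) := by gcongr
        _ = exp (-((c + κ / 4) * s + κ / 8 * s)) := by
          rw [← exp_add]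
          congr 1
          ring
        _ ≤ _ := by
          apply exp_le_exp.2
          have := mul_le_mul_of_nonneg_right h1 (by linarith : 0 ≤ s)
          linarith
    rw [hE]
    nlinarith
  have hθ : x ^ θ ≤ E := by
    rw [hE, rpow_def_of_pos hx0]
    nth_rewrite 2 [← exp_log hx0]
    rw [← exp_add]
    apply exp_le_exp.2
    nlinarith
  have hbad : ((⌊x⌋₊ / H + 1 : ℕ) : ℝ) * k ≤ 2 * E := by
    have h1 : ((⌊x⌋₊ / H : ℕ) : ℝ) ≤ 2 * x * exp (-(b * s)) := by
      calc ((⌊x⌋₊ / H : ℕ) : ℝ) ≤ (⌊x⌋₊ : ℝ) / H := Nat.cast_div_le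
        _ ≤ x / (exp (b * s) / 2) := by
          gcongr
          exact Nat.floor_le hx0.le
        _ = _ := by
          rw [exp_neg]
          field_simp
    -- Here `b ≥ 2 * c + κ` is needed: bad numbers have density about exp(-(b - c)s).
    have h2 : 4 * exp (-(b * s)) * exp (c * s) ≤ exp (-((c + κ / 2) * s)) := by
      have h : 4 ≤ exp (κ * s / 2) := by
        have := add_one_le_exp (κ * s / 2)
        linarith
      calc _ ≤ exp (κ * s / 2) * exp (-(b * s)) * exp (c * s) := by gcongr
        _ = exp (κ * s / 2 - b * s + c * s) := by
          rw [← exp_add, ← exp_add]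
          congr 1
        _ ≤ _ := by
          apply exp_le_exp.2
          have := mul_le_mul_of_nonneg_right hb' (by linarith : 0 ≤ s)
          linarith
    have h3 : 2 * exp (c * s) ≤ E := by
      have h : 2 ≤ exp s := by
        have := add_one_le_exp s
        linarith
      rw [hE]
      calc _ ≤ exp s * exp (c * s) := by gcongr
        _ = exp (s + c * s) := by rw [← exp_add]
        _ ≤ exp (log x + -((c + κ / 2) * s)) := by
          apply exp_le_exp.2
          nlinarith
        _ = _ := by rw [exp_add, exp_log hx0]
    push_cast
    calc _ ≤ (2 * x * exp (-(b * s)) + 1) * (2 * exp (c * s)) := by gcongr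
      _ = x * (4 * exp (-(b * s)) * exp (c * s)) + 2 * exp (c * s) := by ring
      _ ≤ x * exp (-((c + κ / 2) * s)) + E := by gcongr
      _ = 2 * E := by ring
  classical
  set B := (Nat.smoothNumbersUpTo ⌊x⌋₊ k).filter fun n => ¬ SquareWithin n H with hB
  have hBcard : (B.card : ℝ) ≤ 2 * E := by
    refine le_trans ?_ hbad
    have := card_not_squareWithin_le k H ⌊x⌋₊ hH0 B
      (fun n hn => (Nat.mem_smoothNumbersUpTo.1 (Finset.mem_filter.1 hn).1).2)
      (fun n hn => (Finset.mem_filter.1 hn).2)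
      (fun n hn => (Nat.mem_smoothNumbersUpTo.1 (Finset.mem_filter.1 hn).1).1)
    exact_mod_cast this
  have hcover : Nat.smoothNumbersUpTo ⌊x⌋₊ k ⊆
      B ∪ Finset.Icc 1 ⌊x ^ θ⌋₊ ∪ hGfin.toFinset := by
    intro n hn
    by_cases hnB : n ∈ B
    · simp [hnB]
    have hsq : SquareWithin n H := by
      by_contra h
      exact hnB (Finset.mem_filter.2 ⟨hn, h⟩)
    rw [Nat.mem_smoothNumbersUpTo] at hn
    by_cases hnθ : (n : ℝ) ≤ x ^ θ
    · have : n ∈ Finset.Icc 1 ⌊x ^ θ⌋₊ :=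
        Finset.mem_Icc.2 ⟨Nat.pos_of_ne_zero hn.2.1, Nat.le_floor hnθ⟩
      exact Finset.mem_union_left _ (Finset.mem_union_right _ this)
    · refine Finset.mem_union_right _ (hGfin.mem_toFinset.2 (hG n (not_le.1 hnθ)
        ((Nat.le_floor_iff hx0.le).1 hn.1) ?_))
      have h1 : squareGap n ≤ H := (squareGap_isLeast n).2 hsq
      exact (Nat.cast_le.2 h1).trans (Nat.floor_le (exp_pos _).le)
  have hcard := (Finset.card_le_card hcover).trans
    ((Finset.card_union_le _ _).trans (Nat.add_le_add_right (Finset.card_union_le _ _) _))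
  rw [Nat.card_Icc, Nat.add_sub_cancel, ← Set.ncard_eq_toFinset_card G hGfin] at hcard
  have hcard' : ((Nat.smoothNumbersUpTo ⌊x⌋₊ k).card : ℝ) ≤
      B.card + (⌊x ^ θ⌋₊ : ℕ) + G.ncard := by exact_mod_cast hcard
  have := Nat.floor_le (rpow_nonneg hx0.le θ)
  linarith

-- With this θ, `(2 + ε) * θ = 2 + 3 * ε / 4`; the drop to `2 + ε / 2` absorbs the `log θ` in `log
-- (log n)`.
open Real in
theorem mul_le_sqrt_log_mul_log_log (ε θ x s n : ℝ) (hε : 0 < ε)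
    (hθ : θ = (2 + 3 * ε / 4) / (2 + ε)) (hx : 1 < x)
    (hs : s = √(log x * log (log x))) (hm : 1 ≤ log (log x))
    (hmθ : -(2 + 3 * ε / 4) * log θ ≤ ε / 4 * log (log x)) (hn : x ^ θ ≤ n) :
    √(2 + ε / 2) * s ≤ √((2 + ε) * log n * log (log n)) := by
  have hθ0 : 0 < θ := by rw [hθ]; positivity
  have hl : 0 < log x := log_pos hx
  have h1 : θ * log x ≤ log n := by
    rw [← log_rpow (by linarith)]
    exact log_le_log (rpow_pos_of_pos (by linarith) _) hn
  have h2 : log θ + log (log x) ≤ log (log n) := by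
    rw [← log_mul hθ0.ne' hl.ne']
    exact log_le_log (by positivity) h1
  have h3 : (2 + ε / 2) * log (log x) ≤ (2 + 3 * ε / 4) * (log θ + log (log x)) := by linarith
  have h4 : 0 ≤ log θ + log (log x) := by
    by_contra h
    push Not at h
    nlinarith
  rw [hs, ← sqrt_mul (by positivity)]
  apply sqrt_le_sqrt
  have h6 : 0 ≤ log n := (by positivity : 0 ≤ θ * log x).trans h1
  have h5 : (2 + ε) * θ = 2 + 3 * ε / 4 := by rw [hθ]; field_simp
  calc (2 + ε / 2) * (log x * log (log x)) = log x * ((2 + ε / 2) * log (log x)) := by ring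
    _ ≤ log x * ((2 + 3 * ε / 4) * (log θ + log (log x))) := by gcongr
    _ = (2 + ε) * (θ * log x) * (log θ + log (log x)) := by rw [← h5]; ring
    _ ≤ _ := by gcongr

theorem theorem1p2 (ε : ℝ) (hε : 0 < ε) :
    ∃ x₀ : ℝ, ∀ x : ℝ, x₀ ≤ x →
      x * Real.exp (-((3 * Real.sqrt 2 / 2 + ε) * Real.sqrt (Real.log x * Real.log (Real.log x))))
        ≤ (Set.ncard {n : ℕ | 3 ≤ n ∧ (n : ℝ) ≤ x ∧
            (squareGap n : ℝ) ≤
              Real.exp (Real.sqrt ((2 + ε) * Real.log n * Real.log (Real.log n)))} : ℝ) := by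
  set b := √(2 + ε / 2) with hb
  have hb2 : √2 < b := Real.sqrt_lt_sqrt (by norm_num) (by linarith)
  obtain ⟨κ, hκ, hκ1, hκb⟩ : ∃ κ : ℝ, 0 < κ ∧ κ ≤ 1 ∧ √2 + κ ≤ b :=
    ⟨min (b - √2) 1, lt_min (by linarith) one_pos, min_le_right _ _, by
      have := min_le_left (b - √2) 1
      linarith⟩
  set θ : ℝ := (2 + 3 * ε / 4) / (2 + ε) with hθ
  have hθ0 : 0 < θ := by positivity
  have hθ1 : θ < 1 := by
    rw [hθ, div_lt_one (by positivity)]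
    linarith
  have hlog := Real.tendsto_log_atTop
  have hlog2 := hlog.comp hlog
  have hpow := tendsto_rpow_atTop hθ0
  obtain ⟨x₀, hx₀⟩ := Filter.eventually_atTop.1 <|
    ((Filter.eventually_gt_atTop (1 : ℝ)).and <|
      (hpow.eventually_ge_atTop 3).and <|
      (hlog2.eventually_ge_atTop (max 1 (max ((2 / (κ / 4 * (1 - κ / 4) * (√2 / 2))) ^ 2)
        (max (48 / κ * 2) (-(2 + 3 * ε / 4) * Real.log θ / (ε / 4)))))).and <|
      (eventually_mul_log_log_le_log 1).and <|
      (eventually_mul_log_log_le_log ((κ / 4)⁻¹ ^ 2)).and <|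
      (eventually_mul_log_log_le_log (4 ^ 2)).and <|
      eventually_mul_log_log_le_log ((2 / (1 - θ)) ^ 2))
  refine ⟨x₀, fun x hx => ?_⟩
  obtain ⟨hx1, hx3, hm, hC1, hC2, hC3, hC4⟩ := hx₀ x hx
  simp only [Function.comp_apply, max_le_iff] at hm
  obtain ⟨hm1, hm2, hm3, hm4⟩ := hm
  have hl0 : 0 < Real.log x := Real.log_pos hx1
  set s := √(Real.log x * Real.log (Real.log x)) with hs
  have hs0 : 0 ≤ s := Real.sqrt_nonneg _
  have hss : s * s = Real.log x * Real.log (Real.log x) :=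
    Real.mul_self_sqrt (by nlinarith)
  -- Since `s * s = log x * log (log x)`, bounds on `C * s` come from thresholds with squared
  -- constants.
  have hbound : ∀ C : ℝ, 0 ≤ C → C ^ 2 * Real.log (Real.log x) ≤ Real.log x →
      C * s ≤ Real.log x := by
    intro C hC h
    refine (pow_le_pow_iff_left₀ (by positivity) hl0.le two_ne_zero).1 ?_
    nlinarith
  have hms : Real.log (Real.log x) ≤ κ / 4 * s := by
    refine (pow_le_pow_iff_left₀ (by linarith) (by positivity) two_ne_zero).1 ?_
    have h : Real.log (Real.log x) ≤ (κ / 4) ^ 2 * Real.log x := by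
      rw [inv_pow, inv_mul_le_iff₀ (by positivity)] at hC2
      exact hC2
    nlinarith
  have hsm : Real.log (Real.log x) ≤ s := by
    have : κ / 4 * s ≤ 1 * s := by gcongr; linarith
    linarith
  have hsqrt2 : 1 ≤ √2 := Real.one_le_sqrt.2 (by norm_num)
  have key := le_ncard_squareGap_le κ θ x s b hκ hκ1 hκb hx1 hs hm1 (by linarith)
    (Real.le_sqrt_of_sq_le hm2) hms (by nlinarith) (hbound 4 (by norm_num) hC3)
    (by
      have h := hbound (2 / (1 - θ)) (div_nonneg (by norm_num) (by linarith)) hC4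
      rw [div_mul_eq_mul_div, div_le_iff₀ (by linarith)] at h
      linarith)
    (G := {n : ℕ | 3 ≤ n ∧ (n : ℝ) ≤ x ∧ (squareGap n : ℝ) ≤
      Real.exp (Real.sqrt ((2 + ε) * Real.log n * Real.log (Real.log n)))})
    (fun n hn hnx hgap => ⟨by exact_mod_cast (hx3.trans hn.le), hnx, hgap.trans
      (Real.exp_le_exp.2 (mul_le_sqrt_log_mul_log_log ε θ x s n hε hθ hx1 hs hm1
        (by rw [div_le_iff₀ (by positivity)] at hm4; linarith) hn.le))⟩)
    ((Set.finite_Iic ⌊x⌋₊).subset fun n hn => Nat.le_floor hn.2.1)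
  refine le_trans ?_ key
  -- The exponent obtained is smaller than required; `κ ≤ 1 ≤ √2` suffices.
  have : √2 / 2 + κ / 2 ≤ 3 * √2 / 2 + ε := by linarith
  gcongr x * Real.exp (-(?_ * s))
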